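/- For a finite group $G$, a subset $B\subseteq G$ is called a difference basis of $G$ if every $g\in G$ can be written as $g=ab^{-1}$ with $a,b\in B$. Let $\Delta[G]$ be the smallest cardinality of a difference basis of $G$, and let $\eth[G]:=\Delta[G]/\sqrt{|G|}$ be the difference characteristic of $G$. Let $C_n$ denote the cyclic group of order $n$. Theorem. Let $p\ge 11$ be a prime number and let $G$ be a finite Abelian $p$-group. Then the supremum $\sup_{k\ge 1}\eth[C_{p^k}]$ is finite and $$\eth[G]\le\frac{\sqrt p-1}{\sqrt p-3}\cdot\sup_{k\ge1}\eth[C_{p^k}]\le\frac{\sqrt p-1}{\sqrt p-3}\cdot\frac{24}{\sqrt{293}}<\sqrt2\cdot\frac{\sqrt p-1}{\sqrt p-3}.$$ -/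

import Mathlib

/-- `B` is a difference basis of the group `G`: each `g : G` is of the form `a * b⁻¹`
with `a, b ∈ B`. -/
def IsDifferenceBasis {G : Type*} [Group G] (B : Finset G) : Prop :=
  ∀ g : G, ∃ a ∈ B, ∃ b ∈ B, g = a * b⁻¹

/-- The difference size of a group: the smallest cardinality of a difference basis. For a finite
group the set of these cardinalities is non-empty, since the whole group is a difference basis. -/
noncomputable def differenceSize (G : Type*) [Group G] : ℕ :=
  sInf {n : ℕ | ∃ B : Finset G, IsDifferenceBasis B ∧ B.card = n}

/-- The difference characteristic of a finite group: its difference size divided by the square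
root of its order. -/
noncomputable def differenceCharacteristic (G : Type*) [Group G] : ℝ :=
  (differenceSize G : ℝ) / √(Nat.card G : ℝ)

/-- The cyclic group of order `n` (for `n ≥ 1`), written multiplicatively. -/
abbrev CyclicGroupOfOrder (n : ℕ) : Type := Multiplicative (ZMod n)

/-!
Let `C` be the supremum of the difference characteristics `ð` of the nontrivial cyclic `p`-groups.
The proof gives the estimate `ð[G] ≤ √p / (√p - 1) * C`, which is stronger than the one claimed.

The bound for `G` comes from a parabola. If `A` is a finite commutative local ring in which `2` is
invertible, the differences of the points `(a, a ^ 2)` cover all pairs `(d, e)` in `A × A` with `d`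
a unit, as `a ^ 2 - b ^ 2 = (a - b) * (a + b)`. The point is that every noncyclic `G` maps onto
`A × A` with *cyclic* kernel `K`, for some `A` of residue field `ZMod p`
(`IsPGroup.exists_surjective_square`). To see this, write `G` as a product of cyclic groups of
orders `p ^ k 0 ≥ p ^ k 1 ≥ …` and take for `A` the product of those of orders
`p ^ k 1, p ^ k 3, …`. It is a ring as the square-zero extension of its largest factor by the
remaining ones. The kernel is kept cyclic by gluing the kernel obtained from `k 2, k 3, …` to the
first factor, see `exists_surjective_square_of_antitone`. Lifting the parabola and multiplying it by
a difference basis of `K` gives all elements of `G` outside a subgroup `N` of index `p`, for which a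
difference basis is added. Hence `ð[G] ≤ ð[K] + ð[N] / √p ≤ C + ð[N] / √p`, and induction on the
order of `G` yields the geometric series with sum `√p / (√p - 1)`.

The bound `C ≤ 24 / √293` comes from Wichmann's rulers. The ruler with parameters `r` and `s` has
`4 * r + s + 3` marks and measures all lengths up to `L = (4 * r + 3) * (r + s + 1) + r`
(`exists_sub_eq_of_le_wichmannRuler_length`), so modulo any `n ≤ 2 * L + 1` its marks form a
difference basis. For `s` close to `2 * r` the number of marks is about `√(3 * L)`, and
suitable parameters satisfy the required bound for every `n ≥ 11` except `n = 32`, which is not a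
power of `p`.
-/

/-! ### Wichmann rulers -/

/-- The marks of the Wichmann ruler with parameters `r` and `s`. Consecutive marks are at distance
`1` (`r` times), `r + 1`, `2r + 1` (`r` times), `4r + 3` (`s` times), `2r + 2` (`r + 1` times) and
`1` (`r` times). -/
def wichmannRuler (r s : ℕ) : Finset ℤ :=
  (Finset.range (r + 1)).image (fun i : ℕ => (i : ℤ)) ∪
  (Finset.range (r + 1)).image (fun j : ℕ => (2 * r + 1) * (j + 1 : ℤ)) ∪
  (Finset.range s).image (fun k : ℕ => (2 * r + 1) * (r + 1) + (4 * r + 3) * (k + 1 : ℤ)) ∪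
  (Finset.range (r + 1)).image
    (fun l : ℕ => (2 * r + 1) * (r + 1) + (4 * r + 3) * s + (2 * r + 2) * (l + 1 : ℤ)) ∪
  (Finset.range r).image (fun i : ℕ => (4 * r + 3) * (r + s + 1) + (i + 1 : ℤ))

lemma card_wichmannRuler_le (r s : ℕ) : (wichmannRuler r s).card ≤ 4 * r + s + 3 := by
  unfold wichmannRuler
  have h (n : ℕ) (f : ℕ → ℤ) : ((Finset.range n).image f).card ≤ n := by
    simpa using Finset.card_image_le (s := Finset.range n) (f := f)
  refine (Finset.card_union_le _ _).trans ?_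
  refine (add_le_add ((Finset.card_union_le _ _).trans (add_le_add ((Finset.card_union_le _ _).trans
    (add_le_add ((Finset.card_union_le _ _).trans (add_le_add (h _ _) (h _ _))) (h _ _)))
    (h _ _))) (h _ _)).trans ?_
  lia

section Marks

variable {r s : ℕ}

lemma mem_wichmannRuler {x : ℤ} : x ∈ wichmannRuler r s ↔
    (∃ i : ℕ, i < r + 1 ∧ (i : ℤ) = x) ∨
    (∃ j : ℕ, j < r + 1 ∧ (2 * r + 1) * (j + 1 : ℤ) = x) ∨
    (∃ k : ℕ, k < s ∧ (2 * r + 1) * (r + 1) + (4 * r + 3) * (k + 1 : ℤ) = x) ∨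
    (∃ l : ℕ, l < r + 1 ∧
      (2 * r + 1) * (r + 1) + (4 * r + 3) * s + (2 * r + 2) * (l + 1 : ℤ) = x) ∨
    (∃ i : ℕ, i < r ∧ (4 * r + 3) * (r + s + 1) + (i + 1 : ℤ) = x) := by
  simp [wichmannRuler]

lemma first_mem_wichmannRuler {i : ℤ} (h0 : 0 ≤ i) (h : i ≤ r) : i ∈ wichmannRuler r s :=
  mem_wichmannRuler.2 <| .inl ⟨i.toNat, by lia, by lia⟩

lemma second_mem_wichmannRuler {j : ℤ} (h0 : 1 ≤ j) (h : j ≤ r + 1) :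
    (2 * r + 1) * j ∈ wichmannRuler r s := by
  refine mem_wichmannRuler.2 <| .inr <| .inl ⟨(j - 1).toNat, by lia, ?_⟩
  rw [Int.toNat_of_nonneg (by lia)]; ring

lemma third_mem_wichmannRuler {k : ℤ} (h0 : 0 ≤ k) (h : k ≤ s) :
    (2 * r + 1) * (r + 1) + (4 * r + 3) * k ∈ wichmannRuler r s := by
  obtain rfl | h1 := h0.eq_or_lt
  · simpa using second_mem_wichmannRuler (r := r) (s := s) (j := r + 1) (by lia) (by lia)
  refine mem_wichmannRuler.2 <| .inr <| .inr <| .inl ⟨(k - 1).toNat, by lia, ?_⟩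
  rw [Int.toNat_of_nonneg (by lia)]; ring

lemma fourth_mem_wichmannRuler {l : ℤ} (h0 : 0 ≤ l) (h : l ≤ r + 1) :
    (2 * r + 1) * (r + 1) + (4 * r + 3) * s + (2 * r + 2) * l ∈ wichmannRuler r s := by
  obtain rfl | h1 := h0.eq_or_lt
  · simpa using third_mem_wichmannRuler (r := r) (s := s) (k := s) (by lia) le_rfl
  refine mem_wichmannRuler.2 <| .inr <| .inr <| .inr <| .inl ⟨(l - 1).toNat, by lia, ?_⟩
  rw [Int.toNat_of_nonneg (by lia)]; ring

lemma fifth_mem_wichmannRuler {i : ℤ} (h0 : 0 ≤ i) (h : i ≤ r) :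
    (4 * r + 3) * (r + s + 1) + i ∈ wichmannRuler r s := by
  obtain rfl | h1 := h0.eq_or_lt
  · convert fourth_mem_wichmannRuler (r := r) (s := s) (l := r + 1) (by lia) le_rfl using 1
    ring
  refine mem_wichmannRuler.2 <| .inr <| .inr <| .inr <| .inr ⟨(i - 1).toNat, by lia, ?_⟩
  rw [Int.toNat_of_nonneg (by lia)]; ring

end Marks

/-- The Wichmann ruler measures every length up to its own. For a length `d`, write
`2 * d = (4 * r + 3) * K + S` with `|S| ≤ 2 * r + 1`. Since `2 * r + 1` and `2 * r + 2` are the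
halves of `4 * r + 3 ∓ 1`, the coordinates `(K, S)` of a difference of two marks are linear in the
positions of these marks in their blocks, so that only linear conditions remain. -/
lemma exists_sub_eq_of_le_wichmannRuler_length (r s : ℕ) (d : ℤ) (hd0 : 0 ≤ d)
    (hd : d ≤ (4 * r + 3) * (r + s + 1) + r) :
    ∃ x ∈ wichmannRuler r s, ∃ y ∈ wichmannRuler r s, d = x - y := by
  obtain ⟨K, S, hKS, hS0, hS1⟩ : ∃ K S : ℤ, 2 * d = (4 * r + 3) * K + S ∧
      -(2 * r + 1) ≤ S ∧ S ≤ 2 * r + 1 := by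
    refine ⟨(2 * d + (2 * r + 1)) / (4 * r + 3),
      (2 * d + (2 * r + 1)) % (4 * r + 3) - (2 * r + 1), ?_, ?_, ?_⟩
    · have := Int.mul_ediv_add_emod (2 * d + (2 * r + 1)) (4 * r + 3)
      lia
    · have := Int.emod_nonneg (2 * d + (2 * r + 1)) (b := 4 * r + 3) (by lia)
      lia
    · have := Int.emod_lt_of_pos (2 * d + (2 * r + 1)) (b := 4 * r + 3) (by lia)
      lia
  have hpar : ∃ c, K = S + 2 * c := by
    refine ⟨d - (2 * r + 1) * K - S, ?_⟩
    linarith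
  obtain ⟨c, hc⟩ := hpar
  have hK0 : 0 ≤ K := by
    by_contra! h
    nlinarith
  have hK1 : K ≤ 2 * (r + s + 1) := by
    by_contra! h
    nlinarith
  -- The blocks of marks, in increasing order, are called `A`, …, `E`. The following facts express
  -- a difference of marks in two blocks in the coordinates `(K, S)`.
  have hDC (k l : ℤ) (hk0 : 0 ≤ k) (hk : k ≤ s) (hl0 : 0 ≤ l) (hl : l ≤ r + 1)
      (hK : K = 2 * k + l) (hS : S = l) :
      ∃ x ∈ wichmannRuler r s, ∃ y ∈ wichmannRuler r s, d = x - y := by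
    refine ⟨_, fourth_mem_wichmannRuler hl0 hl, _,
      third_mem_wichmannRuler (k := s - k) (by omega) (by omega), ?_⟩
    subst hS hK; linarith
  have hCB (k j : ℤ) (hk0 : 0 ≤ k) (hk : k ≤ s) (hj0 : 0 ≤ j) (hj : j ≤ r)
      (hK : K = 2 * k + j) (hS : S = -j) :
      ∃ x ∈ wichmannRuler r s, ∃ y ∈ wichmannRuler r s, d = x - y := by
    refine ⟨_, third_mem_wichmannRuler hk0 hk, _,
      second_mem_wichmannRuler (j := r + 1 - j) (by omega) (by omega), ?_⟩
    subst hS hK; linarith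
  have hCA (k i : ℤ) (hk0 : 0 ≤ k) (hk : k ≤ s) (hi0 : 0 ≤ i) (hi : i ≤ r)
      (hKS' : (4 * r + 3) * K + S = (4 * r + 3) * (2 * k + r + 1) - (r + 1) - 2 * i) :
      ∃ x ∈ wichmannRuler r s, ∃ y ∈ wichmannRuler r s, d = x - y := by
    refine ⟨_, third_mem_wichmannRuler hk0 hk, _, first_mem_wichmannRuler hi0 hi, ?_⟩
    linarith
  have hEC (k i : ℤ) (hk0 : 0 ≤ k) (hk : k ≤ s) (hi0 : 0 ≤ i) (hi : i ≤ r)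
      (hKS' : (4 * r + 3) * K + S = (4 * r + 3) * (2 * k + r + 1) + (r + 1) + 2 * i) :
      ∃ x ∈ wichmannRuler r s, ∃ y ∈ wichmannRuler r s, d = x - y := by
    refine ⟨_, fifth_mem_wichmannRuler hi0 hi, _,
      third_mem_wichmannRuler (k := s - k) (by omega) (by omega), ?_⟩
    linarith
  have hDB (j l : ℤ) (hj0 : 0 ≤ j) (hj : j ≤ r) (hl0 : 0 ≤ l) (hl : l ≤ r + 1)
      (hK : K = 2 * s + j + l) (hS : S = l - j) :
      ∃ x ∈ wichmannRuler r s, ∃ y ∈ wichmannRuler r s, d = x - y := by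
    refine ⟨_, fourth_mem_wichmannRuler hl0 hl, _,
      second_mem_wichmannRuler (j := r + 1 - j) (by omega) (by omega), ?_⟩
    subst hS hK; linarith
  have hBA (i : ℤ) (hi0 : 0 ≤ i) (hi : i ≤ r) (hK : 1 ≤ K) (hK' : K ≤ r + 1)
      (hS : S = -K - 2 * i) :
      ∃ x ∈ wichmannRuler r s, ∃ y ∈ wichmannRuler r s, d = x - y := by
    refine ⟨_, second_mem_wichmannRuler hK hK', _, first_mem_wichmannRuler hi0 hi, ?_⟩
    subst hS; linarith
  have hED (i : ℤ) (hi0 : 0 ≤ i) (hi : i ≤ r) (hK : 0 ≤ K) (hK' : K ≤ r + 1)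
      (hS : S = K + 2 * i) :
      ∃ x ∈ wichmannRuler r s, ∃ y ∈ wichmannRuler r s, d = x - y := by
    refine ⟨_, fifth_mem_wichmannRuler hi0 hi, _,
      fourth_mem_wichmannRuler (l := r + 1 - K) (by omega) (by omega), ?_⟩
    subst hS; linarith
  have hEB (i j : ℤ) (hi0 : 0 ≤ i) (hi : i ≤ r) (hj0 : 1 ≤ j) (hj : j ≤ r + 1)
      (hK : K = 2 * (r + s + 1) - j) (hS : S = j + 2 * i) :
      ∃ x ∈ wichmannRuler r s, ∃ y ∈ wichmannRuler r s, d = x - y := by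
    refine ⟨_, fifth_mem_wichmannRuler hi0 hi, _, second_mem_wichmannRuler hj0 hj, ?_⟩
    subst hS hK; linarith
  have hDA (i l : ℤ) (hi0 : 0 ≤ i) (hi : i ≤ r) (hl0 : 0 ≤ l) (hl : l ≤ r + 1)
      (hK : K = 2 * (r + s + 1) - l) (hS : S = -l - 2 * i) :
      ∃ x ∈ wichmannRuler r s, ∃ y ∈ wichmannRuler r s, d = x - y := by
    refine ⟨_, fourth_mem_wichmannRuler (l := r + 1 - l) (by omega) (by omega), _,
      first_mem_wichmannRuler hi0 hi, ?_⟩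
    subst hS hK; linarith
  have hEA (i : ℤ) (hi0 : 0 ≤ i) (hi : i ≤ r) (hK : K = 2 * (r + s + 1)) (hS : S = 2 * i) :
      ∃ x ∈ wichmannRuler r s, ∃ y ∈ wichmannRuler r s, d = x - y := by
    refine ⟨_, fifth_mem_wichmannRuler hi0 hi, _,
      first_mem_wichmannRuler (i := 0) le_rfl (by omega), ?_⟩
    subst hS hK; linarith
  -- For small and for large `K` the blocks of unit steps suffice.
  by_cases hlow : K ≤ r + 1 ∧ K ≤ |S|
  · obtain hS | hS := le_or_gt 0 S
    · rw [abs_of_nonneg hS] at hlow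
      exact hED (-c) (by omega) (by omega) hK0 hlow.1 (by omega)
    · rw [abs_of_neg hS] at hlow
      have : K ≠ 0 := by
        rintro rfl
        lia
      exact hBA (-S - c) (by omega) (by omega) (by omega) hlow.1 (by omega)
  by_cases hhigh : 2 * (r + s + 1) - K ≤ r + 1 ∧ 2 * (r + s + 1) - K ≤ |S|
  · obtain hS | hS := le_or_gt 0 S
    · rw [abs_of_nonneg hS] at hhigh
      obtain hj | hj := eq_or_lt_of_le hK1
      · exact hEA (r + s + 1 - c) (by omega) (by omega) hj (by omega)
      · exact hEB (S + c - (r + s + 1)) (2 * (r + s + 1) - K) (by omega) (by omega) (by omega) hhigh.1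
          (by omega) (by omega)
    · rw [abs_of_neg hS] at hhigh
      exact hDA (c - (r + s + 1)) (2 * (r + s + 1) - K) (by omega) (by omega) (by omega) hhigh.1
        (by omega) (by omega)
  obtain hS | hS := le_or_gt 0 S
  · rw [abs_of_nonneg hS] at hlow hhigh
    obtain hSr | hSr := le_or_gt S (r + 1)
    · obtain hKs | hKs := le_or_gt K (2 * s + S)
      · exact hDC c S (by omega) (by omega) hS hSr (by omega) rfl
      · exact hDB (c - s) (S + c - s) (by omega) (by omega) (by omega) (by omega) (by omega) (by omega)
    · obtain ⟨e, he | he⟩ : ∃ e, K = 2 * e + r + 1 ∨ K = 2 * e + r := ⟨(K - r) / 2, by omega⟩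
      · exact hEC e (e + r + 1 - c - (r + 1)) (by omega) (by omega) (by omega) (by omega) (by
          subst he; linarith)
      · -- Here `(K, S)` is replaced by `(K + 1, S - (4 * r + 3))`.
        exact hCA e (c - e + r + 1) (by omega) (by omega) (by omega) (by omega) (by subst he; linarith)
  · rw [abs_of_neg hS] at hlow hhigh
    obtain hSr | hSr := le_or_gt (-S) r
    · obtain hKs | hKs := le_or_gt K (2 * s - S)
      · exact hCB (c + S) (-S) (by omega) (by omega) (by omega) hSr (by omega) (by omega)
      · exact hDB (c - s) (S + c - s) (by omega) (by omega) (by omega) (by omega) (by omega) (by omega)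
    · obtain ⟨e, he | he⟩ : ∃ e, K = 2 * e + r + 1 ∨ K = 2 * e + r + 2 :=
        ⟨(K - r - 1) / 2, by omega⟩
      · exact hCA e (c - e - (r + 1)) (by omega) (by omega) (by omega) (by omega) (by
          subst he; linarith)
      · -- Here `(K, S)` is replaced by `(K - 1, S + (4 * r + 3))`.
        exact hEC e (e - c + 2 * r + 2) (by omega) (by omega) (by omega) (by omega) (by
          subst he; linarith)

/-! ### Difference sizes of groups -/

section DifferenceSize

variable {G Q : Type*} [Group G] [Group Q]

lemma IsDifferenceBasis.differenceSize_le {B : Finset G} (hB : IsDifferenceBasis B) :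
    differenceSize G ≤ B.card :=
  Nat.sInf_le ⟨B, hB, rfl⟩

lemma exists_isDifferenceBasis_card_eq (G : Type*) [Group G] [Finite G] :
    ∃ B : Finset G, IsDifferenceBasis B ∧ B.card = differenceSize G := by
  have := Fintype.ofFinite G
  refine Nat.sInf_mem (s := {n : ℕ | ∃ B : Finset G, IsDifferenceBasis B ∧ B.card = n})
    ⟨_, Finset.univ, fun g => ⟨g, Finset.mem_univ _, 1, Finset.mem_univ _, by simp⟩, rfl⟩

lemma differenceSize_le_of_surjective [Finite G] (f : G →* Q) (hf : Function.Surjective f) :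
    differenceSize Q ≤ differenceSize G := by
  classical
  obtain ⟨B, hB, hcard⟩ := exists_isDifferenceBasis_card_eq G
  rw [← hcard]
  refine le_trans (IsDifferenceBasis.differenceSize_le (B := B.image f) fun q => ?_)
    Finset.card_image_le
  obtain ⟨g, rfl⟩ := hf q
  obtain ⟨a, ha, b, hb, rfl⟩ := hB g
  exact ⟨f a, Finset.mem_image_of_mem f ha, f b, Finset.mem_image_of_mem f hb, by simp⟩

lemma differenceCharacteristic_congr [Finite G] (e : G ≃* Q) :
    differenceCharacteristic G = differenceCharacteristic Q := by
  have : Finite Q := Finite.of_equiv G e.toEquiv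
  have h : differenceSize G = differenceSize Q :=
    le_antisymm (differenceSize_le_of_surjective e.symm.toMonoidHom e.symm.surjective)
      (differenceSize_le_of_surjective e.toMonoidHom e.surjective)
  rw [differenceCharacteristic, differenceCharacteristic, h, Nat.card_congr e.toEquiv]

/-- The difference characteristic is at least `1`, as a set of `m` elements has at most `m ^ 2`
differences. -/
lemma one_le_differenceCharacteristic (G : Type*) [Group G] [Finite G] :
    1 ≤ differenceCharacteristic G := by
  classical
  have := Fintype.ofFinite G
  obtain ⟨B, hB, hcard⟩ := exists_isDifferenceBasis_card_eq G
  have hle : Nat.card G ≤ differenceSize G ^ 2 := by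
    have huniv : (Finset.univ : Finset G) ⊆ (B ×ˢ B).image fun x => x.1 * x.2⁻¹ := by
      intro g _
      obtain ⟨a, ha, b, hb, rfl⟩ := hB g
      exact Finset.mem_image.2 ⟨(a, b), Finset.mk_mem_product ha hb, rfl⟩
    calc Nat.card G = (Finset.univ : Finset G).card := by
          rw [Nat.card_eq_fintype_card, Finset.card_univ]
      _ ≤ _ := (Finset.card_le_card huniv).trans Finset.card_image_le
      _ = differenceSize G ^ 2 := by rw [Finset.card_product, hcard, sq]
  have hpos : (0 : ℝ) < Nat.card G := by exact_mod_cast Nat.card_pos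
  rw [differenceCharacteristic, one_le_div (Real.sqrt_pos.2 hpos)]
  exact Real.sqrt_le_iff.2 ⟨by positivity, by exact_mod_cast hle⟩

end DifferenceSize

/-- If `T` is a set in the quotient `Q` of `G` whose differences cover the image of the complement
of a subgroup `N`, then products of lifts of `T` with a difference basis of the kernel, together
with a difference basis of `N`, form a difference basis of `G`. -/
lemma differenceSize_le_of_cover {G Q : Type*} [CommGroup G] [Finite G] [CommGroup Q]
    (φ : G →* Q) (hφ : Function.Surjective φ) (T : Finset Q) (N : Subgroup G)
    (hT : ∀ g ∉ N, ∃ a ∈ T, ∃ b ∈ T, φ g = a * b⁻¹) :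
    differenceSize G ≤ T.card * differenceSize φ.ker + differenceSize N := by
  classical
  obtain ⟨B, hB, hBcard⟩ := exists_isDifferenceBasis_card_eq φ.ker
  obtain ⟨C, hC, hCcard⟩ := exists_isDifferenceBasis_card_eq N
  rw [← hBcard, ← hCcard]
  set σ := Function.surjInv hφ
  have hσ (t : Q) : φ (σ t) = t := Function.surjInv_eq hφ t
  set D : Finset G := (T ×ˢ B).image (fun x => σ x.1 * x.2) ∪ C.image (fun x : N => (x : G))
  have hD : IsDifferenceBasis D := by
    intro g
    by_cases hg : g ∈ N
    · obtain ⟨a, ha, b, hb, hab⟩ := hC ⟨g, hg⟩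
      exact ⟨a, Finset.mem_union_right _ (Finset.mem_image_of_mem _ ha), b,
        Finset.mem_union_right _ (Finset.mem_image_of_mem _ hb), by
          simpa using congrArg Subtype.val hab⟩
    · obtain ⟨s, hs, t, ht, hst⟩ := hT g hg
      obtain ⟨a, ha, b, hb, hab⟩ := hB ⟨(σ s)⁻¹ * g * σ t, by
        rw [MonoidHom.mem_ker]; simp [hst, hσ]⟩
      have hab' : (σ s)⁻¹ * g * σ t = a * (b : G)⁻¹ := by
        simpa using congrArg Subtype.val hab
      refine ⟨σ s * a, Finset.mem_union_left _ (Finset.mem_image.2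
        ⟨(s, a), Finset.mk_mem_product hs ha, rfl⟩), σ t * b, Finset.mem_union_left _
        (Finset.mem_image.2 ⟨(t, b), Finset.mk_mem_product ht hb, rfl⟩), ?_⟩
      calc g = σ s * ((σ s)⁻¹ * g * σ t) * (σ t)⁻¹ := by group
        _ = _ := by rw [hab']; group
  refine hD.differenceSize_le.trans ((Finset.card_union_le _ _).trans ?_)
  refine add_le_add (Finset.card_image_le.trans ?_) Finset.card_image_le
  rw [Finset.card_product]

/-! ### Cyclic groups -/

/-- A Wichmann ruler of length at least `(n - 1) / 2` is a difference basis modulo `n`. -/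
lemma differenceSize_cyclicGroupOfOrder_le {n : ℕ} [NeZero n] (r s : ℕ)
    (h : n ≤ 2 * ((4 * r + 3) * (r + s + 1) + r) + 1) :
    differenceSize (CyclicGroupOfOrder n) ≤ 4 * r + s + 3 := by
  classical
  refine le_trans (IsDifferenceBasis.differenceSize_le
    (B := (wichmannRuler r s).image fun x : ℤ => Multiplicative.ofAdd (x : ZMod n)) fun g => ?_)
    (Finset.card_image_le.trans (card_wichmannRuler_le r s))
  set z : ZMod n := Multiplicative.toAdd g
  have hz : ((z.valMinAbs : ℤ) : ZMod n) = z := ZMod.coe_valMinAbs z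
  have habs : z.valMinAbs.natAbs ≤ n / 2 := ZMod.natAbs_valMinAbs_le z
  have habs' : (z.valMinAbs.natAbs : ℤ) ≤ (4 * r + 3) * (r + s + 1) + r := by
    have : z.valMinAbs.natAbs ≤ (4 * r + 3) * (r + s + 1) + r := by omega
    exact_mod_cast this
  obtain ⟨x, hx, y, hy, hxy⟩ :=
    exists_sub_eq_of_le_wichmannRuler_length r s _ (by positivity) habs'
  have key (u v : ℤ) (huv : z.valMinAbs = u - v) :
      g = Multiplicative.ofAdd (u : ZMod n) * (Multiplicative.ofAdd (v : ZMod n))⁻¹ := by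
    rw [← ofAdd_neg, ← ofAdd_add, ← sub_eq_add_neg, ← Int.cast_sub, ← huv, hz]
    rfl
  obtain hs | hs := Int.natAbs_eq z.valMinAbs
  · exact ⟨_, Finset.mem_image_of_mem _ hx, _, Finset.mem_image_of_mem _ hy,
      key x y (hs.trans hxy)⟩
  · exact ⟨_, Finset.mem_image_of_mem _ hy, _, Finset.mem_image_of_mem _ hx,
      key y x (hs.trans (by rw [hxy, neg_sub]))⟩

/-- Parameters of a Wichmann ruler that is long enough and has few marks. The order `32` is an
exception: a Wichmann ruler of length at least `16` has at least `8` marks, and `8 / √32 = √2`. -/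
lemma exists_wichmannRuler_parameters {n : ℕ} (hn : 11 ≤ n) (hn' : n ≠ 32) :
    ∃ r s : ℕ, n ≤ 2 * ((4 * r + 3) * (r + s + 1) + r) + 1 ∧
      293 * (4 * r + s + 3) ^ 2 ≤ 576 * n := by
  by_cases h45 : n ≤ 45
  · obtain h | h | h | h | h : n ≤ 13 ∨ (14 ≤ n ∧ n ≤ 19) ∨ (20 ≤ n ∧ n ≤ 25) ∨
        (26 ≤ n ∧ n ≤ 31) ∨ 33 ≤ n := by omega
    exacts [⟨0, 1, by omega, by omega⟩, ⟨0, 2, by omega, by omega⟩, ⟨0, 3, by omega, by omega⟩,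
      ⟨1, 0, by omega, by omega⟩, ⟨1, 1, by omega, by omega⟩]
  -- The ruler with parameters `r` and `2 * r - 1` works up to `n = 24 * r ^ 2 + 20 * r + 1`, and
  -- raising `s` by `1` raises this bound by `8 * r + 6`.
  have hex : ∃ m : ℕ, n ≤ 24 * (m + 1) ^ 2 + 20 * (m + 1) + 1 := ⟨n, by nlinarith⟩
  obtain ⟨r, hr0, hr1, hr2⟩ : ∃ r : ℕ, 1 ≤ r ∧ 24 * r ^ 2 + 20 * r + 1 < n ∧
      n ≤ 24 * (r + 1) ^ 2 + 20 * (r + 1) + 1 := by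
    refine ⟨Nat.find hex, ?_, ?_, Nat.find_spec hex⟩
    · exact (Nat.le_find_iff hex 1).2 fun m hm => by
        obtain rfl : m = 0 := by omega
        omega
    · have h0 : Nat.find hex ≠ 0 := by
        intro h
        have := Nat.find_spec hex
        rw [h] at this
        omega
      obtain ⟨m, hm⟩ := Nat.exists_eq_succ_of_ne_zero h0
      rw [hm]
      exact not_le.1 (Nat.find_min hex (hm ▸ Nat.lt_succ_self m))
  have step (t : ℕ) (hlo : 24 * r ^ 2 + 20 * r + 1 + t * (8 * r + 6) < n) (ht : t ≤ 4)
      (hup : n ≤ 24 * r ^ 2 + 28 * r + 7 + t * (8 * r + 6)) :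
      ∃ r s : ℕ, n ≤ 2 * ((4 * r + 3) * (r + s + 1) + r) + 1 ∧
        293 * (4 * r + s + 3) ^ 2 ≤ 576 * n := by
    refine ⟨r, 2 * r + t, hup.trans (by nlinarith), ?_⟩
    interval_cases t <;> nlinarith
  obtain h | h := le_or_gt n (24 * r ^ 2 + 28 * r + 7)
  · exact step 0 (by lia) (by lia) (by lia)
  obtain h | h := le_or_gt n (24 * r ^ 2 + 36 * r + 13)
  · exact step 1 (by lia) (by lia) (by lia)
  obtain h | h := le_or_gt n (24 * r ^ 2 + 44 * r + 19)
  · exact step 2 (by lia) (by lia) (by lia)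
  obtain h | h := le_or_gt n (24 * r ^ 2 + 52 * r + 25)
  · exact step 3 (by lia) (by lia) (by lia)
  obtain h | h := le_or_gt n (24 * r ^ 2 + 60 * r + 31)
  · exact step 4 (by lia) (by lia) (by lia)
  · exact ⟨r + 1, 2 * r + 1, by nlinarith, by nlinarith⟩

/-- `24 / √293` bounds the difference characteristic of every cyclic group of order at least `11`
and different from `32`. -/
lemma differenceCharacteristic_cyclicGroupOfOrder_le {n : ℕ} (hn : 11 ≤ n) (hn' : n ≠ 32) :
    differenceCharacteristic (CyclicGroupOfOrder n) ≤ 24 / √293 := by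
  have : NeZero n := ⟨by omega⟩
  obtain ⟨r, s, hlen, hmarks⟩ := exists_wichmannRuler_parameters hn hn'
  have hle := differenceSize_cyclicGroupOfOrder_le r s hlen
  have hsq : 293 * differenceSize (CyclicGroupOfOrder n) ^ 2 ≤ 576 * n :=
    (Nat.mul_le_mul_left _ (Nat.pow_le_pow_left hle 2)).trans hmarks
  have hcard : Nat.card (CyclicGroupOfOrder n) = n := by simp
  have hpos : (0 : ℝ) < n := by exact_mod_cast (by omega : 0 < n)
  rw [differenceCharacteristic, hcard, div_le_div_iff₀ (Real.sqrt_pos.2 hpos) (by positivity)]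
  refine abs_le_of_sq_le_sq' ?_ (by positivity) |>.2
  rw [mul_pow, mul_pow, Real.sq_sqrt (by norm_num), Real.sq_sqrt hpos.le]
  have hsq' : (293 : ℝ) * differenceSize (CyclicGroupOfOrder n) ^ 2 ≤ 576 * n := by
    exact_mod_cast hsq
  linarith

/-! ### The parabola in a square-zero extension -/

/-- The parabola `a ↦ (a, a ^ 2)` in the square of the trivial square-zero extension of `R` by `M`:
the point `a = (x, m)` has the square `(x * x, (2 * x) • m)`. -/
def squareZeroParabola (R M : Type*) [CommRing R] [AddCommGroup M] [Module R M] (a : R × M) :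
    (R × M) × (R × M) :=
  (a, (a.1 * a.1, (2 * a.1) • a.2))

/-- The differences of points of the parabola cover all pairs with invertible first component:
`a ^ 2 - b ^ 2 = (a - b) * (a + b)` determines `a + b` once `a - b` is invertible. -/
lemma exists_squareZeroParabola_sub {R M : Type*} [CommRing R] [AddCommGroup M] [Module R M]
    (h2 : IsUnit (2 : R)) (q : (R × M) × (R × M)) (hq : IsUnit q.1.1) :
    ∃ a b : R × M, q = squareZeroParabola R M a - squareZeroParabola R M b := by
  obtain ⟨⟨d, δ⟩, e, ε⟩ := q
  obtain ⟨h, hh⟩ := h2.exists_left_inv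
  obtain ⟨u, hu⟩ := hq.exists_left_inv
  dsimp at hu
  -- `(σ, τ)` is the sum of the two points.
  obtain ⟨σ, hσ⟩ : ∃ σ : R, d * σ = e := ⟨u * e, by linear_combination e * hu⟩
  obtain ⟨τ, hτ⟩ : ∃ τ : M, d • τ + σ • δ = ε := by
    refine ⟨u • (ε - σ • δ), ?_⟩
    rw [smul_smul, mul_comm, hu, one_smul, sub_add_cancel]
  refine ⟨(h * (σ + d), h • (τ + δ)), (h * (σ - d), h • (τ - δ)), ?_⟩
  have hh' (m : M) : (2 * h) • m = m := by rw [mul_comm, hh, one_smul]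
  simp only [squareZeroParabola, Prod.mk_sub_mk, Prod.mk.injEq]
  refine ⟨⟨by linear_combination -d * hh, ?_⟩, ?_, ?_⟩
  · calc δ = (2 * h) • δ := (hh' δ).symm
      _ = _ := by module
  · rw [← hσ]
    linear_combination (-(1 + 2 * h) * d * σ) * hh
  · calc ε = d • τ + σ • δ := hτ.symm
      _ = (2 * h) • (2 * h) • (d • τ + σ • δ) := by rw [hh', hh']
      _ = _ := by module

/-! ### Quotients that are squares -/

lemma exists_injective_zmod_pow_hom {p a N : ℕ} (hp : 0 < p) (h : a ≤ N) :
    ∃ ι : ZMod (p ^ a) →+ ZMod (p ^ N), Function.Injective ι := by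
  have hN : p ^ (N - a) * p ^ a = p ^ N := by rw [← pow_add, Nat.sub_add_cancel h]
  let f : ℤ →+ ZMod (p ^ N) := (zmultiplesHom _) ((p ^ (N - a) : ℕ) : ZMod (p ^ N))
  have hf (z : ℤ) : f z = ((p ^ (N - a) : ℕ) * z : ℤ) := by
    simp [f, mul_comm]
  refine ⟨ZMod.lift (p ^ a) ⟨f, ?_⟩, (ZMod.lift_injective _).2 fun z hz => ?_⟩
  · rw [hf, ← Nat.cast_mul, hN, Int.cast_natCast, ZMod.natCast_self]
  · rw [ZMod.intCast_zmod_eq_zero_iff_dvd]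
    have hz' : f z = 0 := hz
    rw [hf, ZMod.intCast_zmod_eq_zero_iff_dvd, ← hN, Nat.cast_mul] at hz'
    exact Int.dvd_of_mul_dvd_mul_left (by positivity) hz'

lemma exists_surjective_zmod_pow_hom {p a b : ℕ} (h : b ≤ a) :
    ∃ π : ZMod (p ^ a) →+ ZMod (p ^ b), Function.Surjective π :=
  ⟨(ZMod.castHom (pow_dvd_pow p h) (ZMod (p ^ b))).toAddMonoidHom,
    ZMod.castHom_surjective (pow_dvd_pow p h)⟩

/-- A product of cyclic groups of orders `p ^ k 0 ≥ p ^ k 1 ≥ …` has a quotient `A × A` with cyclic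
kernel. Here `A` is the product of the groups of orders `p ^ k 1, p ^ k 3, …`, and cyclicity of the
kernel is witnessed by a homomorphism `ψ` to a cyclic group that is injective on it. Allowing all
large `N` in place of the largest exponent `k 0` makes the induction from `k 2, k 3, …`
possible. -/
lemma exists_surjective_square_of_antitone {p : ℕ} (hp : 0 < p) :
    ∀ (d : ℕ) (k : Fin d → ℕ), Antitone k → (∀ i, 0 < k i) →
    ∃ (A : Type) (_ : AddCommGroup A) (_ : Finite A)
      (φ : (∀ i, ZMod (p ^ k i)) →+ A × A), Function.Surjective φ ∧
      (∀ N, (∀ i, k i ≤ N) → (∀ a : A, p ^ N • a = 0) ∧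
        ∃ ψ : (∀ i, ZMod (p ^ k i)) →+ ZMod (p ^ N), ∀ x, φ x = 0 → ψ x = 0 → x = 0) ∧
      (Subsingleton A ∨ ∃ (b : ℕ) (M : Type) (_ : AddCommGroup M) (_ : Finite M), 0 < b ∧
        (∀ m : M, p ^ b • m = 0) ∧ Nonempty (A ≃+ ZMod (p ^ b) × M))
  | 0, k, _, _ => by
    refine ⟨Unit, inferInstance, inferInstance, 0, fun _ => ⟨0, Subsingleton.elim _ _⟩,
      fun N _ => ⟨fun _ => Subsingleton.elim _ _, 0, fun x _ _ => Subsingleton.elim _ _⟩,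
      .inl inferInstance⟩
  | 1, k, _, _ => by
    refine ⟨Unit, inferInstance, inferInstance, 0, fun _ => ⟨0, Subsingleton.elim _ _⟩,
      fun N hN => ⟨fun _ => Subsingleton.elim _ _, ?_⟩, .inl inferInstance⟩
    obtain ⟨ι, hι⟩ := exists_injective_zmod_pow_hom hp (hN 0)
    refine ⟨ι.comp (Pi.evalAddMonoidHom _ 0), fun x _ hx => funext fun i => ?_⟩
    rw [Subsingleton.elim i 0]
    exact hι (hx.trans (map_zero ι).symm)
  | d + 2, k, hk, hk0 => by
    obtain ⟨A, _, _, φ, hφ, hφN, -⟩ := exists_surjective_square_of_antitone hp d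
      (fun i => k i.succ.succ) (fun i j hij => hk (by simpa using hij)) (fun i => hk0 _)
    have hk1 (i : Fin d) : k i.succ.succ ≤ k 1 := hk (Fin.le_def.2 (by simp))
    obtain ⟨hA, ψ, hψ⟩ := hφN (k 1) hk1
    obtain ⟨π, hπ⟩ := exists_surjective_zmod_pow_hom (p := p) (hk (Fin.zero_le 1) : k 1 ≤ k 0)
    have : NeZero (p ^ k 1) := ⟨by positivity⟩
    let tail : (∀ i, ZMod (p ^ k i)) →+ (∀ i : Fin d, ZMod (p ^ k i.succ.succ)) :=
      { toFun := fun x i => x i.succ.succ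
        map_zero' := rfl
        map_add' := fun _ _ => rfl }
    let Φ : (∀ i, ZMod (p ^ k i)) →+ (ZMod (p ^ k 1) × A) × (ZMod (p ^ k 1) × A) :=
      { toFun := fun x => ((π (x 0) + ψ (tail x), (φ (tail x)).1), (x 1, (φ (tail x)).2))
        map_zero' := by simp
        map_add' := fun x y => by
          simp only [map_add, Pi.add_apply, Prod.fst_add, Prod.snd_add, Prod.mk_add_mk]
          rw [add_add_add_comm] }
    refine ⟨ZMod (p ^ k 1) × A, inferInstance, inferInstance, Φ, ?_, fun N hN => ⟨?_, ?_⟩,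
      .inr ⟨k 1, A, inferInstance, inferInstance, hk0 1, hA, ⟨AddEquiv.refl _⟩⟩⟩
    · rintro ⟨⟨u, a⟩, v, b⟩
      obtain ⟨y, hy⟩ := hφ (a, b)
      obtain ⟨x, hx⟩ := hπ (u - ψ y)
      refine ⟨Fin.cons x (Fin.cons v y : ∀ i : Fin (d + 1), ZMod (p ^ k i.succ)), ?_⟩
      have htail : tail (Fin.cons x (Fin.cons v y : ∀ i : Fin (d + 1), ZMod (p ^ k i.succ))) = y :=
        rfl
      change ((π x + ψ y, (φ y).1), (v, (φ y).2)) = _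
      rw [hx, hy, sub_add_cancel]
    · intro a
      have hd : p ^ k 1 ∣ p ^ N := pow_dvd_pow p (hN 1)
      ext
      · rw [Prod.smul_fst, nsmul_eq_mul, (ZMod.natCast_eq_zero_iff _ _).2 hd, zero_mul]; rfl
      · obtain ⟨c, hc⟩ := hd
        rw [Prod.smul_snd, hc, mul_comm, mul_smul, hA, smul_zero]; rfl
    · obtain ⟨ι, hι⟩ := exists_injective_zmod_pow_hom hp (hN 0)
      refine ⟨ι.comp (Pi.evalAddMonoidHom _ 0), fun x hx hx0 => ?_⟩
      have h0 : x 0 = 0 := hι (hx0.trans (map_zero ι).symm)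
      have hx' : ((π (x 0) + ψ (tail x), (φ (tail x)).1), (x 1, (φ (tail x)).2)) =
        ((0, 0), (0, 0)) := hx
      simp only [Prod.mk.injEq, h0, map_zero, zero_add] at hx'
      have htail : tail x = 0 := hψ _ (Prod.ext hx'.1.2 hx'.2.2) hx'.1.1
      funext i
      refine Fin.cases h0 (fun i => Fin.cases hx'.2.1 (fun i => congrFun htail i) i) i

/-- A finite commutative `p`-group is a product of cyclic groups `ZMod (p ^ k i)`, in decreasing
order. -/
lemma IsPGroup.exists_mulEquiv_pi_zmod {p : ℕ} (hp : p.Prime) {G : Type*} [CommGroup G] [Finite G]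
    (hG : IsPGroup p G) :
    ∃ (d : ℕ) (k : Fin d → ℕ), Antitone k ∧ (∀ i, 0 < k i) ∧
      Nonempty (G ≃* Multiplicative (∀ i, ZMod (p ^ k i))) := by
  classical
  have := Fact.mk hp
  obtain ⟨ι, _, n, hn, ⟨e⟩⟩ := CommGroup.equiv_prod_multiplicative_zmod_of_finite G
  have hk (i : ι) : ∃ k, n i = p ^ k := by
    have : NeZero (n i) := ⟨by have := hn i; omega⟩
    have hcyc : IsPGroup p (Multiplicative (ZMod (n i))) :=
      hG.of_surjective ((Pi.evalMonoidHom _ i).comp e.toMonoidHom)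
        ((Function.surjective_eval i).comp e.surjective)
    obtain ⟨k, hk⟩ := IsPGroup.iff_card.1 hcyc
    exact ⟨k, by simpa using hk⟩
  choose k hk using hk
  obtain rfl : n = fun i => p ^ k i := funext hk
  let τ : Fin (Fintype.card ι) ≃ ι := (Fintype.equivFin ι).symm
  let κ : Fin (Fintype.card ι) → ℕᵒᵈ := fun i => OrderDual.toDual (k (τ i))
  let ρ : Fin (Fintype.card ι) ≃ ι := (Tuple.sort κ).trans τ
  refine ⟨Fintype.card ι, fun i => k (ρ i), fun i j hij => Tuple.monotone_sort κ hij,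
    fun i => Nat.pos_of_ne_zero fun h => ?_, ⟨e.trans ?_⟩⟩
  · have := hn (ρ i)
    simp only [h, pow_zero, lt_irrefl] at this
  · refine MulEquiv.symm ?_
    exact AddEquiv.toMultiplicative
      { toFun := fun x => (Equiv.piCongrLeft (fun i => ZMod (p ^ k i)) ρ) x
        invFun := fun x => (Equiv.piCongrLeft (fun i => ZMod (p ^ k i)) ρ).symm x
        left_inv := fun x => by simp
        right_inv := fun x => by simp
        map_add' := fun x y => by
          funext i
          obtain ⟨j, rfl⟩ := ρ.surjective i
          simp [Equiv.piCongrLeft_apply_apply] }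

/-- A noncyclic finite commutative `p`-group maps onto the square of the additive group of a local
ring, namely a square-zero extension of `ZMod (p ^ b)`, with cyclic kernel. -/
lemma IsPGroup.exists_surjective_square {p : ℕ} (hp : p.Prime) {G : Type*} [CommGroup G] [Finite G]
    (hG : IsPGroup p G) (hcyc : ¬ IsCyclic G) :
    ∃ (b : ℕ) (M : Type) (_ : AddCommGroup M) (_ : Finite M) (_ : Module (ZMod (p ^ b)) M)
      (φ : G →* Multiplicative ((ZMod (p ^ b) × M) × (ZMod (p ^ b) × M))), 0 < b ∧
      Function.Surjective φ ∧ IsCyclic φ.ker := by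
  obtain ⟨d, k, hk, hk0, ⟨e⟩⟩ := hG.exists_mulEquiv_pi_zmod hp
  obtain ⟨A, _, _, φ, hφ, hφN, hA⟩ := exists_surjective_square_of_antitone hp.pos d k hk hk0
  obtain ⟨N, hN⟩ : ∃ N, ∀ i, k i ≤ N :=
    ⟨Finset.univ.sup k, fun i => Finset.le_sup (Finset.mem_univ i)⟩
  obtain ⟨-, ψ, hψ⟩ := hφN N hN
  let Φ : G →* Multiplicative (A × A) := (AddMonoidHom.toMultiplicative φ).comp e.toMonoidHom
  let Ψ : G →* Multiplicative (ZMod (p ^ N)) :=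
    (AddMonoidHom.toMultiplicative ψ).comp e.toMonoidHom
  have hΦ : Function.Surjective Φ := hφ.comp e.surjective
  have hinj (g : G) (h1 : Φ g = 1) (h2 : Ψ g = 1) : g = 1 :=
    e.injective ((hψ (Multiplicative.toAdd (e g)) h1 h2).trans (map_one e).symm)
  have hker : IsCyclic Φ.ker := by
    refine isCyclic_of_injective (Ψ.comp Φ.ker.subtype) ?_
    rw [injective_iff_map_eq_one]
    exact fun g hg => Subtype.ext (hinj g g.2 hg)
  obtain hA | ⟨b, M, _, _, hb, hM, ⟨f⟩⟩ := hA
  · -- If `A` is trivial, the kernel is the whole group.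
    refine absurd (isCyclic_of_injective Ψ ?_) hcyc
    rw [injective_iff_map_eq_one]
    exact fun g hg => hinj g (Subsingleton.elim (α := A × A) _ _) hg
  · let _ : Module (ZMod (p ^ b)) M := AddCommGroup.zmodModule hM
    let F := AddEquiv.toMultiplicative (AddEquiv.prodCongr f f)
    refine ⟨b, M, inferInstance, inferInstance, inferInstance, F.toMonoidHom.comp Φ, hb,
      F.surjective.comp hΦ, ?_⟩
    have hkerF : (F.toMonoidHom.comp Φ).ker = Φ.ker := by
      ext g
      simp [MonoidHom.mem_ker]
    rw [hkerF]
    exact hker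

/-! ### Difference characteristics of commutative `p`-groups -/

/-- The recursion step: outside a subgroup `N` of index `p`, the parabola in a quotient of `G` and a
difference basis of a cyclic kernel provide all elements of `G`. -/
lemma IsPGroup.exists_differenceCharacteristic_le_add {p : ℕ} (hp : p.Prime) (hp2 : p ≠ 2)
    {G : Type*} [CommGroup G] [Finite G] (hG : IsPGroup p G) (hcyc : ¬ IsCyclic G) :
    ∃ K N : Subgroup G, IsCyclic K ∧ Nat.card G = p * Nat.card N ∧
      differenceCharacteristic G ≤
        differenceCharacteristic K + differenceCharacteristic N / √(p : ℝ) := by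
  classical
  obtain ⟨b, M, _, _, _, φ, hb, hφ, hker⟩ := hG.exists_surjective_square hp hcyc
  have := Fact.mk hp
  have : NeZero (p ^ b) := ⟨(pow_pos hp.pos b).ne'⟩
  have := Fintype.ofFinite M
  let R := ZMod (p ^ b)
  let ρ : R →+* ZMod p := ZMod.castHom (dvd_pow_self p hb.ne') (ZMod p)
  have hρ : Function.Surjective ρ := ZMod.castHom_surjective _
  have hunit (x : R) (hx : ρ x ≠ 0) : IsUnit x := by
    rw [← ZMod.natCast_zmod_val x] at hx ⊢
    rw [ZMod.isUnit_iff_coprime]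
    refine Nat.Coprime.pow_right b ((Nat.coprime_comm.1 ((hp.coprime_iff_not_dvd).2 ?_)))
    rwa [map_natCast, Ne, ZMod.natCast_eq_zero_iff] at hx
  let χ : G →* Multiplicative (ZMod p) :=
    (AddMonoidHom.toMultiplicative (ρ.toAddMonoidHom.comp ((AddMonoidHom.fst R M).comp
      (AddMonoidHom.fst (R × M) (R × M))))).comp φ
  have hχ : Function.Surjective χ := fun z => by
    obtain ⟨x, hx⟩ := hρ (Multiplicative.toAdd z)
    obtain ⟨g, hg⟩ := hφ (Multiplicative.ofAdd ((x, 0), 0))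
    refine ⟨g, ?_⟩
    change Multiplicative.ofAdd (ρ (Multiplicative.toAdd (φ g)).1.1) = z
    rw [hg]
    exact congrArg Multiplicative.ofAdd hx
  have hcardN : Nat.card G = p * Nat.card χ.ker := by
    rw [← χ.ker.card_mul_index, Subgroup.index_ker, MonoidHom.range_eq_top.2 hχ, mul_comm]
    simp
  have hcardK : Nat.card G = Nat.card (R × M) ^ 2 * Nat.card φ.ker := by
    rw [← φ.ker.card_mul_index, Subgroup.index_ker, MonoidHom.range_eq_top.2 hφ, mul_comm,
      Subgroup.card_top, Nat.card_congr Multiplicative.toAdd, Nat.card_prod, sq]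
  have h2 : IsUnit (2 : R) := by
    have : IsUnit ((2 : ℕ) : R) := (ZMod.isUnit_iff_coprime 2 (p ^ b)).2
      (Nat.Coprime.pow_right b ((Nat.coprime_primes Nat.prime_two hp).2 hp2.symm))
    exact_mod_cast this
  let T : Finset (Multiplicative ((R × M) × (R × M))) :=
    Finset.univ.image fun a : R × M => Multiplicative.ofAdd (squareZeroParabola R M a)
  have hTcard : T.card ≤ Nat.card (R × M) := by
    rw [Nat.card_eq_fintype_card]
    exact Finset.card_image_le
  have hsize : differenceSize G ≤ Nat.card (R × M) * differenceSize φ.ker +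
      differenceSize χ.ker := by
    refine (differenceSize_le_of_cover φ hφ T χ.ker fun g hg => ?_).trans
      (Nat.add_le_add_right (Nat.mul_le_mul_right _ hTcard) _)
    obtain ⟨a, c, hac⟩ := exists_squareZeroParabola_sub h2 (Multiplicative.toAdd (φ g))
      (hunit _ fun h => hg h)
    refine ⟨_, Finset.mem_image_of_mem _ (Finset.mem_univ a), _,
      Finset.mem_image_of_mem _ (Finset.mem_univ c), ?_⟩
    rw [← ofAdd_neg, ← ofAdd_add, ← sub_eq_add_neg, ← hac]
    rfl
  refine ⟨φ.ker, χ.ker, hker, hcardN, ?_⟩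
  have hA : (0 : ℝ) < Nat.card (R × M) := by exact_mod_cast Nat.card_pos
  have hK : (0 : ℝ) < √(Nat.card φ.ker : ℝ) := Real.sqrt_pos.2 (by exact_mod_cast Nat.card_pos)
  have hN : (0 : ℝ) < √(Nat.card χ.ker : ℝ) := Real.sqrt_pos.2 (by exact_mod_cast Nat.card_pos)
  have hsp : (0 : ℝ) < √(p : ℝ) := Real.sqrt_pos.2 (by exact_mod_cast hp.pos)
  have hs1 : √(Nat.card G : ℝ) = Nat.card (R × M) * √(Nat.card φ.ker : ℝ) := by
    rw [hcardK, Nat.cast_mul, Nat.cast_pow, Real.sqrt_mul (by positivity), Real.sqrt_sq hA.le]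
  have hs2 : √(Nat.card G : ℝ) = √(p : ℝ) * √(Nat.card χ.ker : ℝ) := by
    rw [hcardN, Nat.cast_mul, Real.sqrt_mul (by positivity)]
  have hsize' : (differenceSize G : ℝ) ≤ Nat.card (R × M) * differenceSize φ.ker +
      differenceSize χ.ker := by exact_mod_cast hsize
  calc differenceCharacteristic G
      ≤ (Nat.card (R × M) * differenceSize φ.ker + differenceSize χ.ker) / √(Nat.card G : ℝ) :=
        div_le_div_of_nonneg_right hsize' (Real.sqrt_nonneg _)
    _ = Nat.card (R × M) * differenceSize φ.ker / (Nat.card (R × M) * √(Nat.card φ.ker : ℝ)) +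
        differenceSize χ.ker / (√(p : ℝ) * √(Nat.card χ.ker : ℝ)) := by
        rw [add_div, ← hs1, ← hs2]
    _ = _ := by
        rw [mul_div_mul_left _ _ hA.ne', differenceCharacteristic, differenceCharacteristic,
          div_div, mul_comm √(p : ℝ)]

lemma differenceCharacteristic_le_one_of_subsingleton (G : Type*) [Group G] [Subsingleton G] :
    differenceCharacteristic G ≤ 1 := by
  have h : differenceSize G ≤ 1 := IsDifferenceBasis.differenceSize_le (B := {1}) fun g =>
    ⟨1, Finset.mem_singleton_self 1, 1, Finset.mem_singleton_self 1, Subsingleton.elim _ _⟩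
  rw [differenceCharacteristic, Nat.card_of_subsingleton (1 : G), Nat.cast_one, Real.sqrt_one,
    div_one]
  exact_mod_cast h

lemma IsPGroup.differenceCharacteristic_le_of_isCyclic {p : ℕ} (hp : p.Prime) {C : ℝ}
    (hC : ∀ k : ℕ+, differenceCharacteristic (CyclicGroupOfOrder (p ^ (k : ℕ))) ≤ C)
    {G : Type*} [Group G] [Finite G] (hG : IsPGroup p G) (hcyc : IsCyclic G) :
    differenceCharacteristic G ≤ C := by
  have := Fact.mk hp
  obtain ⟨k, hk⟩ := IsPGroup.iff_card.1 hG
  obtain rfl | hk0 := Nat.eq_zero_or_pos k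
  · have : Subsingleton G := Finite.card_le_one_iff_subsingleton.1 (by rw [hk, pow_zero])
    have : NeZero (p ^ ((1 : ℕ+) : ℕ)) := ⟨(pow_pos hp.pos _).ne'⟩
    exact (differenceCharacteristic_le_one_of_subsingleton G).trans
      ((one_le_differenceCharacteristic _).trans (hC 1))
  · have e : CyclicGroupOfOrder (Nat.card G) ≃* G := zmodCyclicMulEquiv hcyc
    rw [← differenceCharacteristic_congr e, hk]
    exact hC ⟨k, hk0⟩

/-- Iterating the recursion step gives the sum `√p / (√p - 1)` of the geometric series with ratio
`1 / √p`. -/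
lemma IsPGroup.differenceCharacteristic_le {p : ℕ} (hp : p.Prime) (hp2 : p ≠ 2) {C : ℝ}
    (hC : ∀ k : ℕ+, differenceCharacteristic (CyclicGroupOfOrder (p ^ (k : ℕ))) ≤ C)
    {G : Type*} [CommGroup G] [Finite G] (hG : IsPGroup p G) :
    differenceCharacteristic G ≤ √(p : ℝ) / (√(p : ℝ) - 1) * C := by
  have hsp : 1 < √(p : ℝ) := by
    rw [Real.lt_sqrt zero_le_one, one_pow]
    exact_mod_cast hp.one_lt
  have hC1 : 0 ≤ C := by
    have : NeZero (p ^ ((1 : ℕ+) : ℕ)) := ⟨(pow_pos hp.pos _).ne'⟩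
    exact zero_le_one.trans ((one_le_differenceCharacteristic _).trans (hC 1))
  have hs0 : √(p : ℝ) - 1 ≠ 0 := (sub_pos.2 hsp).ne'
  have hs1 : √(p : ℝ) ≠ 0 := (zero_lt_one.trans hsp).ne'
  have hsum : √(p : ℝ) / (√(p : ℝ) - 1) * C =
      C + √(p : ℝ) / (√(p : ℝ) - 1) * C / √(p : ℝ) := by
    field_simp
    ring
  induction hn : Nat.card G using Nat.strong_induction_on generalizing G with
  | _ n ih =>
    rw [hsum]
    by_cases hcyc : IsCyclic G
    · refine (hG.differenceCharacteristic_le_of_isCyclic hp hC hcyc).trans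
        (le_add_of_nonneg_right ?_)
      have := sub_pos.2 hsp
      positivity
    · obtain ⟨K, N, hK, hcard, hle⟩ := hG.exists_differenceCharacteristic_le_add hp hp2 hcyc
      have hlt : Nat.card N < n := by
        rw [← hn, hcard]
        exact lt_mul_of_one_lt_left Nat.card_pos hp.one_lt
      exact hle.trans (add_le_add
        ((hG.to_subgroup K).differenceCharacteristic_le_of_isCyclic hp hC hK)
        (div_le_div_of_nonneg_right (ih _ hlt (hG.to_subgroup N) rfl) (Real.sqrt_nonneg _)))

theorem theorem6p3 (p : ℕ) (hp : p.Prime) (hp11 : 11 ≤ p)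
    (G : Type*) [CommGroup G] [Finite G] (hG : IsPGroup p G) :
    BddAbove (Set.range fun k : ℕ+ =>
      differenceCharacteristic (CyclicGroupOfOrder (p ^ (k : ℕ)))) ∧
    differenceCharacteristic G ≤
      (√(p : ℝ) - 1) / (√(p : ℝ) - 3) *
        (⨆ k : ℕ+, differenceCharacteristic (CyclicGroupOfOrder (p ^ (k : ℕ)))) ∧
    (√(p : ℝ) - 1) / (√(p : ℝ) - 3) *
        (⨆ k : ℕ+, differenceCharacteristic (CyclicGroupOfOrder (p ^ (k : ℕ)))) ≤
      (√(p : ℝ) - 1) / (√(p : ℝ) - 3) * (24 / √293) ∧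
    (√(p : ℝ) - 1) / (√(p : ℝ) - 3) * (24 / √293) <
      (√(p : ℝ) - 1) / (√(p : ℝ) - 3) * √2 := by
  have hcyc (k : ℕ+) :
      differenceCharacteristic (CyclicGroupOfOrder (p ^ (k : ℕ))) ≤ 24 / √293 := by
    refine differenceCharacteristic_cyclicGroupOfOrder_le
      (hp11.trans (Nat.le_self_pow k.ne_zero p)) fun h => ?_
    have h2 : p ∣ 2 ^ 5 := (dvd_pow_self p k.ne_zero).trans (by rw [h]; norm_num)
    have := Nat.le_of_dvd two_pos (hp.dvd_of_dvd_pow h2)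
    omega
  have hbdd : BddAbove (Set.range fun k : ℕ+ =>
      differenceCharacteristic (CyclicGroupOfOrder (p ^ (k : ℕ)))) :=
    ⟨_, Set.forall_mem_range.2 hcyc⟩
  have hsp : 3 < √(p : ℝ) := by
    rw [Real.lt_sqrt (by norm_num)]
    exact lt_of_lt_of_le (by norm_num) (Nat.cast_le (α := ℝ).2 hp11)
  have hfac : 0 < (√(p : ℝ) - 1) / (√(p : ℝ) - 3) := div_pos (by linarith) (by linarith)
  refine ⟨hbdd, ?_, mul_le_mul_of_nonneg_left (ciSup_le hcyc) hfac.le,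
    mul_lt_mul_of_pos_left ?_ hfac⟩
  · refine (hG.differenceCharacteristic_le hp (by omega) (le_ciSup hbdd)).trans
      (mul_le_mul_of_nonneg_right ?_ ?_)
    · rw [div_le_div_iff₀ (by linarith) (by linarith)]
      linarith
    · have : NeZero (p ^ ((1 : ℕ+) : ℕ)) := ⟨(pow_pos hp.pos _).ne'⟩
      exact zero_le_one.trans ((one_le_differenceCharacteristic _).trans (le_ciSup hbdd 1))
  · rw [div_lt_iff₀ (by positivity), ← Real.sqrt_mul (by norm_num), Real.lt_sqrt (by norm_num)]
    norm_num
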